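/- For $k\ge 0$ let $F_k$ be the free group on $k$ generators $a_1,\dots,a_k$, let $\sigma_k\in \mathrm{Aut}(F_k)$ be the automorphism with $a_i\mapsto a_i^{-1}$ for every $i$, and let $\Pi A(F_k)\le \mathrm{Aut}(F_k)$ be the palindromic automorphism group, i.e. the subgroup of all automorphisms $\alpha$ such that, for each $i$, the reduced word of $\alpha(a_i)$ is a palindrome (equal to its reverse). Let $p$ be an odd prime, let $n\ge p$ and put $m=n-p$. Let $P_n\cong\mathbb{Z}/p$ be the group of rotations of $p$ letters, generated by a $p$-cycle in the symmetric group $\Sigma_p$; regard it also as the subgroup of $\mathrm{Aut}(F_n)$ that rotates the first $p$ generators $a_1,\dots,a_p$ cyclically and fixes $a_{p+1},\dots,a_n$. Then $P_n$ and $\sigma_n$ generate a subgroup $P_n\times\langle\sigma_n\rangle$ of $\mathrm{Aut}(F_n)$, and there is an isomorphism of groups $$N_{\mathrm{Aut}(F_n)}(P_n\times\langle\sigma_n\rangle)\;\cong\; N_{\Sigma_p}(P_n)\times\bigl(F_m\rtimes(\langle\sigma_p\rangle\times\Pi A(F_m))\bigr),$$ where $N$ denotes the normalizer and, in the semidirect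 product, $\Pi A(F_m)$ acts on $F_m$ in the natural way (as a group of automorphisms of $F_m$) and $\sigma_p$ acts on $F_m$ as $\sigma_m$ does. -/

import Mathlib

namespace PalAut

/-- The free group `F_n` on the generators `a_0, …, a_{n-1}`. -/
abbrev F (n : ℕ) : Type := FreeGroup (Fin n)

/-- The automorphism `σ_n` of `F_n` inverting every generator. -/
def sigma (n : ℕ) : MulAut (F n) :=
  MonoidHom.toMulEquiv
    (FreeGroup.lift fun i => (FreeGroup.of i)⁻¹)
    (FreeGroup.lift fun i => (FreeGroup.of i)⁻¹)
    (by ext i; simp) (by ext i; simp)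

@[simp]
theorem sigma_of (n : ℕ) (i : Fin n) :
    sigma n (FreeGroup.of i) = (FreeGroup.of i)⁻¹ := by
  simp [sigma]

theorem sigma_mul_self (n : ℕ) : sigma n * sigma n = 1 := by
  apply MulEquiv.toMonoidHom_injective
  ext i
  simp

/-- An element of `F_n` is a palindrome if the reduced word representing it equals its reverse. -/
def IsPalindrome {n : ℕ} (w : F n) : Prop :=
  w.toWord.reverse = w.toWord

theorem sigma_mk (n : ℕ) (L : List (Fin n × Bool)) :
    sigma n (FreeGroup.mk L) = (FreeGroup.mk L.reverse)⁻¹ := by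
  induction L with
  | nil => simp [← FreeGroup.one_eq_mk]
  | cons x L ih =>
    have h : FreeGroup.mk (x :: L) = FreeGroup.mk [x] * FreeGroup.mk L := by simp
    have h' : FreeGroup.mk (x :: L).reverse = FreeGroup.mk L.reverse * FreeGroup.mk [x] := by simp
    have hx : sigma n (FreeGroup.mk [x]) = (FreeGroup.mk [x])⁻¹ := by
      obtain ⟨i, b⟩ := x
      cases b
      · have e : (FreeGroup.mk [(i, false)] : F n) = (FreeGroup.of i)⁻¹ := by
          simp [FreeGroup.of, FreeGroup.invRev]
        rw [e, map_inv, sigma_of]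
      · exact sigma_of n i
    rw [h, h', map_mul, ih, hx, mul_inv_rev]

theorem isPalindrome_iff {n : ℕ} (w : F n) : IsPalindrome w ↔ sigma n w = w⁻¹ := by
  have h : sigma n w = (FreeGroup.mk w.toWord.reverse)⁻¹ := by
    conv_lhs => rw [← FreeGroup.mk_toWord (x := w)]
    exact sigma_mk n _
  have hr : FreeGroup.IsReduced w.toWord.reverse := by
    have h0 : FreeGroup.IsReduced w.toWord := FreeGroup.isReduced_toWord
    unfold FreeGroup.IsReduced at h0 ⊢
    rw [List.isChain_reverse]
    refine h0.imp ?_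
    intro a b hab e
    exact (hab e.symm).symm
  rw [h, inv_inj, IsPalindrome]
  constructor
  · intro e
    rw [e, FreeGroup.mk_toWord]
  · intro e
    have := congrArg FreeGroup.toWord e
    rwa [FreeGroup.toWord_mk, hr.reduce_eq] at this

theorem palindromic_iff_commute {n : ℕ} (α : MulAut (F n)) :
    (∀ i, IsPalindrome (α (FreeGroup.of i))) ↔ Commute (sigma n) α := by
  simp only [isPalindrome_iff]
  constructor
  · intro h
    apply MulEquiv.toMonoidHom_injective
    ext i
    simpa using h i
  · intro h i
    have := DFunLike.congr_fun h.eq (FreeGroup.of i)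
    simpa using this

/-- The palindromic automorphism group `ΠA(F_n)`: the automorphisms of `F_n` sending
every generator to a palindrome. -/
def PiA (n : ℕ) : Subgroup (MulAut (F n)) where
  carrier := {α | ∀ i, IsPalindrome (α (FreeGroup.of i))}
  one_mem' := (palindromic_iff_commute 1).2 (Commute.one_right _)
  mul_mem' {α β} hα hβ := (palindromic_iff_commute (α * β)).2
    (((palindromic_iff_commute α).1 hα).mul_right ((palindromic_iff_commute β).1 hβ))
  inv_mem' {α} hα := (palindromic_iff_commute α⁻¹).2
    ((palindromic_iff_commute α).1 hα).inv_right

/-- The homomorphism `Σ_n → Aut(F_n)` permuting the generators. -/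
def permAut (n : ℕ) : Equiv.Perm (Fin n) →* MulAut (F n) where
  toFun e := FreeGroup.freeGroupCongr e
  map_one' := FreeGroup.freeGroupCongr_refl
  map_mul' e f := (FreeGroup.freeGroupCongr_trans f e).symm

/-- The inclusion `Σ_p → Aut(F_n)`, `p ≤ n`: permute the first `p` generators and fix
the others. -/
noncomputable def permFirst {p n : ℕ} (h : p ≤ n) : Equiv.Perm (Fin p) →* MulAut (F n) :=
  (permAut n).comp (Equiv.Perm.viaEmbeddingHom (Fin.castLEEmb h))

/-- The cyclic group of rotations of `p` letters, as a subgroup of `Σ_p`. -/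
def rot (p : ℕ) : Subgroup (Equiv.Perm (Fin p)) :=
  Subgroup.zpowers (finRotate p)

/-- `P_n ⊆ Aut(F_n)`: rotate the first `p` generators and fix the others. -/
noncomputable def P {p n : ℕ} (h : p ≤ n) : Subgroup (MulAut (F n)) :=
  (rot p).map (permFirst h)

theorem mem_zpowers_sigma {p : ℕ} (x : Subgroup.zpowers (sigma p)) :
    (x : MulAut (F p)) = 1 ∨ (x : MulAut (F p)) = sigma p := by
  obtain ⟨_, k, rfl⟩ := x
  have h2 : sigma p ^ (2 : ℤ) = 1 := by rw [zpow_two, sigma_mul_self]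
  rcases Int.even_or_odd' k with ⟨l, rfl | rfl⟩
  · left; simp [zpow_mul, h2]
  · right; simp [zpow_add, zpow_mul, h2]

open Classical in
/-- The action of `⟨σ_p⟩` on `F_m` through `σ_m`: the identity acts trivially and `σ_p`
(when it is not the identity) acts as `σ_m`. -/
noncomputable def sigmaAct (p m : ℕ) : Subgroup.zpowers (sigma p) →* MulAut (F m) where
  toFun x := if (x : MulAut (F p)) = 1 then 1 else sigma m
  map_one' := by simp
  map_mul' x y := by
    by_cases h : sigma p = 1
    · rcases mem_zpowers_sigma x with hx | hx <;> rcases mem_zpowers_sigma y with hy | hy <;>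
        simp [hx, hy, h]
    · rcases mem_zpowers_sigma x with hx | hx <;> rcases mem_zpowers_sigma y with hy | hy <;>
        simp [hx, hy, h, sigma_mul_self]

/-- The action of `⟨σ_p⟩ × ΠA(F_m)` on `F_m`: `σ_p` acts as `σ_m`, and `ΠA(F_m)` acts
in the natural way. -/
noncomputable def act (p m : ℕ) : Subgroup.zpowers (sigma p) × PiA m →* MulAut (F m) :=
  MonoidHom.noncommCoprod (sigmaAct p m) (PiA m).subtype (by
    intro x α
    have h : Commute (sigma m) (α : MulAut (F m)) := (palindromic_iff_commute _).1 α.2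
    by_cases hx : (x : MulAut (F p)) = 1
    · simp [sigmaAct, hx]
    · simpa [sigmaAct, hx] using h)

end PalAut

/-!
Write `n = p + m` and `F_n = F_p * F_m`, let `t` be the rotation of the first `p` generators
`a_i`, and let `σ` invert every generator. The group `P_n` has odd order and commutes with `σ`, so
`σ` is the only involution of `P_n × ⟨σ⟩` and `P_n` is the set of its elements of odd order. Hence
`α` lies in the normalizer if and only if `α` commutes with `σ`, i.e. is palindromic, and
normalizes `P_n`.

Three families of such automorphisms generate the image of `fullHom`: the permutations of the `a_i`
normalizing the rotations; the free products `γ * β` with `γ ∈ ⟨σ_p⟩` and `β ∈ ΠA(F_m)`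
(`prodAut`); and the twists `a_i ↦ w⁻¹ a_i σ(w)` with `w ∈ F_m` (`twist`). The twists form a copy
of `F_m` on which the second family acts by conjugation as in the semidirect product
(`prodAut_mul_twist_act`), and the first family commutes with everything else. The resulting
homomorphism is injective because a twist that preserves both free factors is trivial:
`w⁻¹ σ(w) = 1` forces `w = 1`.

Surjectivity onto the normalizer is the substance (`normalizer_le_range`). Since `α` normalizes the
rotations, it preserves the fixed subgroup `F_m` of `t` (`exists_restrict`), so it may be assumed to
fix `F_m` pointwise. The reduced word of `α(a_0)` is a palindrome `u M uʳ` with `u` a word in the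
last `m` generators and `M` beginning and ending with the same letter `a_l^{±1}`; composing with a
twist removes `u` (`mem_range_of_fix`). Now `α(a_i)` is the rotation by `t^{ki}` of `M`, so it
begins and ends with one and the same letter, and these letters are distinct up to sign for
distinct `i`, as `α` is injective and the rotations act freely.
Therefore the images of the letters of a reduced word never cancel against each other
(`toWord_hom_eq_flatMap`), and lengths add up. As `a_0` is in the image of `α`, the word `M` has
length one (`exists_length_eq_one`), and `α` is a signed permutation.
-/

namespace PalAut

open FreeGroup (of mk toWord mk_toWord one_eq_mk mul_mk toWord_eq_nil_iff invRev isReduced_toWord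
  toWord_mk freeGroupCongr of_ne_one toWord_inv)

/-! ### Reduced words -/

/-- If no cancellation occurs between the images of consecutive letters, then the reduced word of
the image is the concatenation of the reduced words of the images of the letters. -/
theorem toWord_hom_eq_flatMap {α β : Type*} [DecidableEq α] [DecidableEq β]
    (f : FreeGroup α →* FreeGroup β) (hne : ∀ x, f (of x) ≠ 1)
    (h : ∀ x y : α × Bool, (x.1 = y.1 → x.2 = y.2) →
      ∀ a ∈ (f (mk [x])).toWord.getLast?, ∀ b ∈ (f (mk [y])).toWord.head?,
        a.1 = b.1 → a.2 = b.2)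
    (z : FreeGroup α) :
    (f z).toWord = z.toWord.flatMap fun x => (f (mk [x])).toWord := by
  have hmk : ∀ L : List (α × Bool), f (mk L) = mk (L.flatMap fun x => (f (mk [x])).toWord) := by
    intro L
    induction L with
    | nil => simp [← one_eq_mk]
    | cons x L ih =>
      have h1 : mk (x :: L) = mk [x] * mk L := by simp
      rw [h1, map_mul, ih, List.flatMap_cons, ← mul_mk, mk_toWord]
  have hne' : ∀ x : α × Bool, (f (mk [x])).toWord ≠ [] := by
    rintro ⟨x, b⟩ hx
    rw [toWord_eq_nil_iff] at hx
    cases b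
    · have e : (mk [(x, false)] : FreeGroup α) = (of x)⁻¹ := by simp [of, invRev]
      rw [e, map_inv, inv_eq_one] at hx
      exact hne x hx
    · exact hne x hx
  have hred : FreeGroup.IsReduced (z.toWord.flatMap fun x => (f (mk [x])).toWord) := by
    unfold FreeGroup.IsReduced
    rw [List.flatMap, List.isChain_flatten (by
      rw [List.mem_map]
      rintro ⟨x, -, hx⟩
      exact hne' x hx)]
    refine ⟨?_, ?_⟩
    · simp only [List.mem_map]
      rintro _ ⟨x, -, rfl⟩
      exact isReduced_toWord
    · rw [List.isChain_map]
      exact (isReduced_toWord (x := z)).imp fun x y hxy => h x y hxy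
  conv_lhs => rw [← mk_toWord (x := z), hmk, toWord_mk, hred.reduce_eq]

theorem toWord_freeGroupCongr {α : Type*} [DecidableEq α] (e : Equiv.Perm α) (z : FreeGroup α) :
    (freeGroupCongr e z).toWord = z.toWord.map fun x => (e x.1, x.2) := by
  have h1 : ∀ x : α × Bool, (freeGroupCongr e (mk [x])).toWord = [(e x.1, x.2)] := by
    rintro ⟨x, b⟩
    simp [freeGroupCongr, toWord_mk]
  have := toWord_hom_eq_flatMap (freeGroupCongr e).toMonoidHom (fun x => by simp)
    (fun x y hxy => by simpa [h1] using hxy) z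
  simpa [h1, ← List.map_eq_flatMap] using this

theorem toWord_sigma {n : ℕ} (w : F n) :
    (sigma n w).toWord = w.toWord.map fun x => (x.1, !x.2) := by
  have h1 : ∀ x : Fin n × Bool, (sigma n (mk [x])).toWord = [(x.1, !x.2)] := by
    rintro x
    simp [sigma_mk, invRev]
  have := toWord_hom_eq_flatMap (sigma n).toMonoidHom (fun x => by simp)
    (fun x y hxy => by simpa [h1] using hxy) w
  simpa [h1, ← List.map_eq_flatMap] using this

theorem eq_one_of_sigma_eq_self {n : ℕ} {w : F n} (h : sigma n w = w) : w = 1 := by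
  rw [← toWord_eq_nil_iff, List.eq_nil_iff_forall_not_mem]
  intro x hx
  have h1 := toWord_sigma w
  rw [h] at h1
  have h2 : w.toWord.map (fun x => (x.1, !x.2)) = w.toWord.map id := by simpa using h1.symm
  have := List.map_inj_left.1 h2 x hx
  have := congrArg Prod.snd this
  simp at this

theorem sigma_ne_one {n : ℕ} (hn : 0 < n) : sigma n ≠ 1 := by
  intro h
  exact of_ne_one (⟨0, hn⟩ : Fin n) (eq_one_of_sigma_eq_self (by rw [h]; rfl))

/-- A palindrome with a letter outside `B` is `u ++ M ++ u.reverse` with all letters of `u` in `B`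
and `M` beginning and ending with the same letter outside `B`. -/
theorem exists_palindrome_core {α : Type*} (B : α → Prop) {L : List α} (hL : L.Palindrome)
    (h : ∃ x ∈ L, ¬ B x) :
    ∃ u M x, L = u ++ M ++ u.reverse ∧ (∀ y ∈ u, B y) ∧ ¬ B x ∧ M.head? = some x ∧
      M.getLast? = some x := by
  induction hL with
  | nil => simp at h
  | singleton x =>
    exact ⟨[], [x], x, by simpa using h⟩
  | cons_concat x hl ih =>
    rename_i l
    by_cases hx : B x
    · obtain ⟨u, M, y, rfl, h2, h3, h4⟩ := ih (by
        obtain ⟨y, hy, hBy⟩ := h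
        refine ⟨y, ?_, hBy⟩
        simp only [List.mem_cons, List.mem_append, List.not_mem_nil, or_false] at hy
        rcases hy with rfl | hy | rfl
        exacts [absurd hx hBy, hy, absurd hx hBy])
      exact ⟨x :: u, M, y, by simp, by simpa using ⟨hx, h2⟩, h3, h4⟩
    · exact ⟨[], x :: (l ++ [x]), x, by simp, by simp, hx, by simp, by
        rw [← List.cons_append, List.getLast?_concat]⟩

/-! ### The splitting of `F (p + m)` as a free product -/

variable {p m : ℕ}

/-- The inclusion of the free factor generated by the first `p` generators. -/
def inl (p m : ℕ) : F p →* F (p + m) := FreeGroup.map (Fin.castAdd m)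

/-- The inclusion of the free factor generated by the last `m` generators. -/
def inr (p m : ℕ) : F m →* F (p + m) := FreeGroup.map (Fin.natAdd p)

@[simp] theorem inl_of (i : Fin p) : inl p m (of i) = of (Fin.castAdd m i) := by simp [inl]

@[simp] theorem inr_of (j : Fin m) : inr p m (of j) = of (Fin.natAdd p j) := by simp [inr]

theorem inl_injective : Function.Injective (inl p m) :=
  FreeGroup.map_injective (Fin.castAdd_injective p m)

theorem inr_injective : Function.Injective (inr p m) :=
  FreeGroup.map_injective (Fin.natAdd_injective m p)

theorem hom_ext {G : Type*} [Group G] {f g : F (p + m) →* G}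
    (hl : ∀ i : Fin p, f (of (Fin.castAdd m i)) = g (of (Fin.castAdd m i)))
    (hr : ∀ j : Fin m, f (of (Fin.natAdd p j)) = g (of (Fin.natAdd p j))) : f = g := by
  ext i
  induction i using Fin.addCases with
  | left i => exact hl i
  | right j => exact hr j

theorem aut_ext {f g : MulAut (F (p + m))}
    (hl : ∀ i : Fin p, f (of (Fin.castAdd m i)) = g (of (Fin.castAdd m i)))
    (hr : ∀ j : Fin m, f (of (Fin.natAdd p j)) = g (of (Fin.natAdd p j))) : f = g :=
  MulEquiv.toMonoidHom_injective (hom_ext hl hr)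

theorem sigma_inr (w : F m) : sigma (p + m) (inr p m w) = inr p m (sigma m w) := by
  have : (sigma (p + m)).toMonoidHom.comp (inr p m) = (inr p m).comp (sigma m).toMonoidHom := by
    ext; simp
  exact DFunLike.congr_fun this w

theorem mem_range_inr {u : List (Fin (p + m) × Bool)}
    (hu : ∀ y ∈ u, y.1 ∈ Set.range (Fin.natAdd p : Fin m → Fin (p + m))) :
    ∃ v, inr p m v = mk u := by
  induction u with
  | nil => exact ⟨1, by simp [← one_eq_mk]⟩
  | cons y u ih =>
    obtain ⟨v, hv⟩ := ih fun z hz => hu z (by simp [hz])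
    obtain ⟨j, hj⟩ := hu y (by simp)
    refine ⟨mk [(j, y.2)] * v, ?_⟩
    rw [map_mul, hv]
    simp [inr, hj]

/-- The free product of two endomorphisms. -/
def prodHom (γ : F p →* F p) (β : F m →* F m) : F (p + m) →* F (p + m) :=
  FreeGroup.lift (Fin.addCases (fun i => inl p m (γ (of i))) fun j => inr p m (β (of j)))

theorem prodHom_inl (γ : F p →* F p) (β : F m →* F m) (x : F p) :
    prodHom γ β (inl p m x) = inl p m (γ x) := by
  have : (prodHom γ β).comp (inl p m) = (inl p m).comp γ := by
    ext; simp [prodHom]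
  exact DFunLike.congr_fun this x

theorem prodHom_inr (γ : F p →* F p) (β : F m →* F m) (x : F m) :
    prodHom γ β (inr p m x) = inr p m (β x) := by
  have : (prodHom γ β).comp (inr p m) = (inr p m).comp β := by
    ext; simp [prodHom]
  exact DFunLike.congr_fun this x

/-- The free product `γ * β` of two automorphisms, as a homomorphism
`Aut(F_p) × Aut(F_m) → Aut(F_{p+m})`. -/
def prodAut (p m : ℕ) : MulAut (F p) × MulAut (F m) →* MulAut (F (p + m)) where
  toFun x := MonoidHom.toMulEquiv (prodHom x.1.toMonoidHom x.2.toMonoidHom)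
    (prodHom x.1⁻¹.toMonoidHom x.2⁻¹.toMonoidHom)
    (by
      apply hom_ext <;> intro i
      · rw [MonoidHom.comp_apply, ← inl_of, prodHom_inl, prodHom_inl]
        simp
      · rw [MonoidHom.comp_apply, ← inr_of, prodHom_inr, prodHom_inr]
        simp)
    (by
      apply hom_ext <;> intro i
      · rw [MonoidHom.comp_apply, ← inl_of, prodHom_inl, prodHom_inl]
        simp
      · rw [MonoidHom.comp_apply, ← inr_of, prodHom_inr, prodHom_inr]
        simp)
  map_one' := by
    apply aut_ext <;> intro i
    · rw [← inl_of]
      simp only [MonoidHom.toMulEquiv_apply, prodHom_inl]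
      rfl
    · rw [← inr_of]
      simp only [MonoidHom.toMulEquiv_apply, prodHom_inr]
      rfl
  map_mul' x y := by
    apply aut_ext <;> intro i
    · rw [MulAut.mul_apply, ← inl_of]
      simp only [MonoidHom.toMulEquiv_apply, prodHom_inl]
      rfl
    · rw [MulAut.mul_apply, ← inr_of]
      simp only [MonoidHom.toMulEquiv_apply, prodHom_inr]
      rfl

@[simp]
theorem prodAut_inl (x : MulAut (F p) × MulAut (F m)) (w : F p) :
    prodAut p m x (inl p m w) = inl p m (x.1 w) :=
  prodHom_inl _ _ _

@[simp]
theorem prodAut_inr (x : MulAut (F p) × MulAut (F m)) (w : F m) :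
    prodAut p m x (inr p m w) = inr p m (x.2 w) :=
  prodHom_inr _ _ _

@[simp]
theorem prodAut_castAdd (x : MulAut (F p) × MulAut (F m)) (i : Fin p) :
    prodAut p m x (of (Fin.castAdd m i)) = inl p m (x.1 (of i)) := by
  rw [← inl_of, prodAut_inl]

@[simp]
theorem prodAut_natAdd (x : MulAut (F p) × MulAut (F m)) (j : Fin m) :
    prodAut p m x (of (Fin.natAdd p j)) = inr p m (x.2 (of j)) := by
  rw [← inr_of, prodAut_inr]

theorem prodAut_injective : Function.Injective (prodAut p m) := by
  rw [injective_iff_map_eq_one]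
  rintro ⟨γ, β⟩ h
  ext1
  · ext x
    apply inl_injective (m := m)
    rw [← prodAut_inl (γ, β), h]
    rfl
  · ext x
    apply inr_injective (p := p)
    rw [← prodAut_inr (γ, β), h]
    rfl

theorem sigma_add : sigma (p + m) = prodAut p m (sigma p, sigma m) := by
  apply aut_ext <;> intro i <;> simp

/-- The endomorphism `a_i ↦ w⁻¹ a_i σ(w)` for `i < p`, fixing the last `m` generators. -/
def twistHom (p : ℕ) {m : ℕ} (w : F m) : F (p + m) →* F (p + m) :=
  FreeGroup.lift (Fin.addCases
    (fun i => (inr p m w)⁻¹ * of (Fin.castAdd m i) * inr p m (sigma m w))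
    fun j => of (Fin.natAdd p j))

theorem twistHom_castAdd (w : F m) (i : Fin p) :
    twistHom p w (of (Fin.castAdd m i)) =
      (inr p m w)⁻¹ * of (Fin.castAdd m i) * inr p m (sigma m w) := by
  simp [twistHom]

theorem twistHom_inr (w x : F m) : twistHom p w (inr p m x) = inr p m x := by
  have : (twistHom p w).comp (inr p m) = inr p m := by
    ext; simp [twistHom]
  exact DFunLike.congr_fun this x

theorem twistHom_comp (v w : F m) :
    (twistHom p v).comp (twistHom p w) = twistHom p (v * w) := by
  apply hom_ext <;> intro i
  · simp only [MonoidHom.comp_apply, twistHom_castAdd, map_mul, map_inv, twistHom_inr, mul_inv_rev,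
      mul_assoc]
  · rw [MonoidHom.comp_apply, ← inr_of, twistHom_inr, twistHom_inr, twistHom_inr]

theorem twistHom_one : twistHom p (1 : F m) = MonoidHom.id _ := by
  apply hom_ext <;> intro i
  · simp [twistHom_castAdd]
  · rw [← inr_of, twistHom_inr, MonoidHom.id_apply]

/-- The automorphisms `a_i ↦ w⁻¹ a_i σ(w)`; the inverse on the left makes this a homomorphism
in `w`. -/
def twist (p m : ℕ) : F m →* MulAut (F (p + m)) where
  toFun w := MonoidHom.toMulEquiv (twistHom p w) (twistHom p w⁻¹)
    (by rw [twistHom_comp, inv_mul_cancel, twistHom_one])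
    (by rw [twistHom_comp, mul_inv_cancel, twistHom_one])
  map_one' := MulEquiv.toMonoidHom_injective twistHom_one
  map_mul' v w := MulEquiv.toMonoidHom_injective (twistHom_comp v w).symm

@[simp]
theorem twist_castAdd (w : F m) (i : Fin p) :
    twist p m w (of (Fin.castAdd m i)) =
      (inr p m w)⁻¹ * of (Fin.castAdd m i) * inr p m (sigma m w) :=
  twistHom_castAdd w i

@[simp]
theorem twist_inr (w x : F m) : twist p m w (inr p m x) = inr p m x :=
  twistHom_inr w x

@[simp]
theorem twist_natAdd (w : F m) (j : Fin m) :
    twist p m w (of (Fin.natAdd p j)) = of (Fin.natAdd p j) := by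
  rw [← inr_of, twist_inr]

/-! ### The homomorphism from the product -/

@[simp]
theorem permAut_of {n : ℕ} (τ : Equiv.Perm (Fin n)) (i : Fin n) :
    permAut n τ (of i) = of (τ i) := by
  simp [permAut]

theorem permAut_injective (n : ℕ) : Function.Injective (permAut n) := by
  intro τ τ' h
  ext1 i
  apply FreeGroup.of_injective
  rw [← permAut_of, h, permAut_of]

theorem viaEmbeddingHom_castAdd (h : p ≤ p + m) (τ : Equiv.Perm (Fin p)) (i : Fin p) :
    Equiv.Perm.viaEmbeddingHom (Fin.castLEEmb h) τ (Fin.castAdd m i) = Fin.castAdd m (τ i) :=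
  Equiv.Perm.viaEmbedding_apply τ (Fin.castLEEmb h) i

theorem viaEmbeddingHom_natAdd (h : p ≤ p + m) (τ : Equiv.Perm (Fin p)) (j : Fin m) :
    Equiv.Perm.viaEmbeddingHom (Fin.castLEEmb h) τ (Fin.natAdd p j) = Fin.natAdd p j := by
  rw [Equiv.Perm.viaEmbeddingHom_apply, Equiv.Perm.viaEmbedding_apply_of_notMem]
  rintro ⟨i, hi⟩
  have := congrArg Fin.val hi
  simp at this
  omega

theorem permFirst_eq (h : p ≤ p + m) (τ : Equiv.Perm (Fin p)) :
    permFirst h τ = prodAut p m (permAut p τ, 1) := by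
  apply aut_ext <;> intro i
  · simp [permFirst, viaEmbeddingHom_castAdd]
  · simp [permFirst, viaEmbeddingHom_natAdd]

theorem sigma_commute_permAut {n : ℕ} (τ : Equiv.Perm (Fin n)) :
    Commute (sigma n) (permAut n τ) := by
  apply MulEquiv.toMonoidHom_injective
  ext i
  simp

theorem permAut_ne_sigma {n : ℕ} (hn : 0 < n) (τ : Equiv.Perm (Fin n)) : permAut n τ ≠ sigma n := by
  intro h
  have := congrArg toWord (DFunLike.congr_fun h (of ⟨0, hn⟩))
  simp [invRev] at this

theorem twist_commute_permAut (w : F m) (τ : Equiv.Perm (Fin p)) :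
    Commute (prodAut p m (permAut p τ, 1)) (twist p m w) := by
  apply aut_ext <;> intro i <;> simp

theorem prodAut_mul_twist (w : F m) {β : MulAut (F m)} (hβ : Commute (sigma m) β) :
    prodAut p m (1, β) * twist p m w = twist p m (β w) * prodAut p m (1, β) := by
  apply aut_ext <;> intro i
  · have : sigma m (β w) = β (sigma m w) := DFunLike.congr_fun hβ.eq w
    simp [this]
  · simp

theorem prodAut_sigma_mul_twist (w : F m) :
    prodAut p m (sigma p, 1) * twist p m w = twist p m (sigma m w) * prodAut p m (sigma p, 1) := by
  have h (x : F m) : sigma m (sigma m x) = x := DFunLike.congr_fun (sigma_mul_self m) x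
  apply aut_ext <;> intro i
  · simp [mul_assoc, h]
  · simp

theorem twist_commute_sigma (w : F m) : Commute (sigma (p + m)) (twist p m w) := by
  have h (x : F m) : sigma m (sigma m x) = x := DFunLike.congr_fun (sigma_mul_self m) x
  apply aut_ext <;> intro i
  · simp [mul_assoc, sigma_inr, h]
  · simp

/-- The image of `(s, β)` acts on the subgroup of twists by conjugation through `act`. -/
theorem prodAut_mul_twist_act (hp : 0 < p) (g : Subgroup.zpowers (sigma p) × PiA m) (w : F m) :
    prodAut p m (g.1, g.2) * twist p m w =
      twist p m (act p m g w) * prodAut p m (g.1, g.2) := by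
  obtain ⟨s, β⟩ := g
  have hβ : Commute (sigma m) (β : MulAut (F m)) := (palindromic_iff_commute _).1 β.2
  have hsplit : prodAut p m (s, β) = prodAut p m (s, 1) * prodAut p m (1, β) := by
    rw [← map_mul]; simp
  have hs : ∀ x, prodAut p m (s, 1) * twist p m x =
      twist p m (sigmaAct p m s x) * prodAut p m (s, 1) := by
    intro x
    rcases mem_zpowers_sigma s with h | h
    · have h1 : prodAut p m (1, 1) = 1 := map_one _
      simp [h, sigmaAct, h1]
    · simpa [h, sigmaAct, sigma_ne_one hp] using prodAut_sigma_mul_twist x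
  simp only [hsplit, mul_assoc]
  rw [prodAut_mul_twist w hβ, ← mul_assoc, hs, mul_assoc]
  rfl

/-- The homomorphism `F_m ⋊ (⟨σ_p⟩ × ΠA(F_m)) → Aut(F_{p+m})` with `w` acting as a twist, `σ_p` on
the first free factor and `ΠA(F_m)` on the second. -/
noncomputable def semidirectHom (hp : 0 < p) :
    F m ⋊[act p m] (Subgroup.zpowers (sigma p) × PiA m) →* MulAut (F (p + m)) :=
  SemidirectProduct.lift (twist p m)
    ((prodAut p m).comp
      (MonoidHom.prodMap (Subgroup.zpowers (sigma p)).subtype (PiA m).subtype))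
    (by
      intro g
      refine MonoidHom.ext fun w => ?_
      simp only [MonoidHom.comp_apply, MulEquiv.coe_toMonoidHom, MulAut.conj_apply]
      exact eq_mul_inv_of_mul_eq (prodAut_mul_twist_act hp g w).symm)

theorem semidirectHom_apply (hp : 0 < p)
    (x : F m ⋊[act p m] (Subgroup.zpowers (sigma p) × PiA m)) :
    semidirectHom hp x =
      twist p m x.left * prodAut p m ((x.right.1 : MulAut (F p)), (x.right.2 : MulAut (F m))) :=
  rfl

theorem permAut_commute_semidirectHom (hp : 0 < p) (τ : Equiv.Perm (Fin p))
    (x : F m ⋊[act p m] (Subgroup.zpowers (sigma p) × PiA m)) :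
    Commute (prodAut p m (permAut p τ, 1)) (semidirectHom hp x) := by
  rw [semidirectHom_apply]
  refine (twist_commute_permAut _ τ).mul_right ?_
  refine (Commute.prod ?_ (Commute.one_left _)).map (prodAut p m)
  rcases mem_zpowers_sigma x.right.1 with h | h
  · simp [h]
  · simpa [h] using (sigma_commute_permAut τ).symm

/-- The homomorphism `N(P) × (F_m ⋊ (⟨σ_p⟩ × ΠA(F_m))) → Aut(F_{p+m})` in which `N(P)` permutes the
first `p` generators; its range is the normalizer of `P × ⟨σ⟩`. -/
noncomputable def fullHom (m : ℕ) (hp : 0 < p) :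
    Subgroup.normalizer (rot p : Set (Equiv.Perm (Fin p))) ×
      (F m ⋊[act p m] (Subgroup.zpowers (sigma p) × PiA m)) →* MulAut (F (p + m)) :=
  MonoidHom.noncommCoprod
    (((prodAut p m).comp (MonoidHom.inl _ _)).comp ((permAut p).comp (Subgroup.subtype _)))
    (semidirectHom hp) (fun τ x => permAut_commute_semidirectHom hp τ x)

theorem fullHom_apply (hp : 0 < p)
    (x : Subgroup.normalizer (rot p : Set (Equiv.Perm (Fin p))) ×
      (F m ⋊[act p m] (Subgroup.zpowers (sigma p) × PiA m))) :
    fullHom m hp x =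
      prodAut p m (permAut p x.1, 1) * (twist p m x.2.left *
        prodAut p m ((x.2.right.1 : MulAut (F p)), (x.2.right.2 : MulAut (F m)))) :=
  rfl

/-- The twists meet the free products of automorphisms trivially. -/
theorem eq_one_of_twist_eq_prodAut (hp : 0 < p) {w : F m} {x : MulAut (F p) × MulAut (F m)}
    (h : twist p m w = prodAut p m x) : w = 1 := by
  -- The retraction onto the second factor turns the image of a generator into `w⁻¹ σ(w)`.
  let π : F (p + m) →* F m := FreeGroup.lift (Fin.addCases (fun _ => 1) fun j => of j)
  have hr : ∀ v, π (inr p m v) = v := by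
    intro v
    have : π.comp (inr p m) = MonoidHom.id _ := by ext; simp [π]
    exact DFunLike.congr_fun this v
  have hl : ∀ v, π (inl p m v) = 1 := by
    intro v
    have : π.comp (inl p m) = 1 := by ext; simp [π]
    exact DFunLike.congr_fun this v
  have h1 := congrArg π (DFunLike.congr_fun h (of (Fin.castAdd m ⟨0, hp⟩)))
  rw [twist_castAdd, ← inl_of, prodAut_inl, map_mul, map_mul, hl, hl, map_inv, hr, hr, mul_one,
    inv_mul_eq_one] at h1
  exact eq_one_of_sigma_eq_self h1.symm

theorem fullHom_injective (hp : 0 < p) : Function.Injective (fullHom m hp) := by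
  rw [injective_iff_map_eq_one]
  rintro ⟨τ, ⟨w, s, β⟩⟩ h
  rw [fullHom_apply] at h
  dsimp only at h
  have h1 : twist p m w =
      prodAut p m ((permAut p τ, 1)⁻¹ * ((s : MulAut (F p)), (β : MulAut (F m)))⁻¹) := by
    rw [map_mul, map_inv, map_inv, eq_mul_inv_iff_mul_eq, eq_inv_iff_mul_eq_one,
      mul_eq_one_comm, h]
  have hw := eq_one_of_twist_eq_prodAut hp h1
  subst hw
  rw [map_one, one_mul, ← map_mul] at h
  have h2 := prodAut_injective (h.trans (map_one (prodAut p m)).symm)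
  simp only [Prod.mk_mul_mk, one_mul, Prod.mk_eq_one] at h2
  obtain ⟨h2, h3⟩ := h2
  have hs : (s : MulAut (F p)) = 1 := by
    rcases mem_zpowers_sigma s with h | h
    · exact h
    · rw [h, mul_eq_one_iff_eq_inv, eq_comm, inv_eq_iff_mul_eq_one.2 (sigma_mul_self p)] at h2
      exact absurd h2.symm (permAut_ne_sigma hp _)
  rw [hs, mul_one] at h2
  have hτ := permAut_injective p (h2.trans (map_one _).symm)
  have e1 : τ = 1 := Subtype.ext hτ
  have e2 : s = 1 := Subtype.ext hs
  have e3 : β = 1 := Subtype.ext h3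
  subst e1 e2 e3
  rfl

/-! ### Rotations -/

theorem finRotate_apply_ne (hp : 2 ≤ p) (i : Fin p) : finRotate p i ≠ i := by
  have : i ∈ (finRotate p).support := by simp [support_finRotate_of_le hp]
  exact Equiv.Perm.mem_support.1 this

theorem exists_finRotate_pow (hp : 2 ≤ p) (i j : Fin p) : ∃ c : ℕ, (finRotate p ^ c) i = j :=
  (isCycle_finRotate_of_le hp).exists_pow_eq (finRotate_apply_ne hp i) (finRotate_apply_ne hp j)

theorem finRotate_pow_self (hp : 2 ≤ p) : finRotate p ^ p = 1 := by
  have h := (isCycle_finRotate_of_le hp).orderOf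
  rw [support_finRotate_of_le hp, Finset.card_univ, Fintype.card_fin] at h
  exact orderOf_dvd_iff_pow_eq_one.1 h.dvd

/-- The rotations act freely. -/
theorem eq_of_mem_rot (hp : 2 ≤ p) {g h : Equiv.Perm (Fin p)} (hg : g ∈ rot p) (hh : h ∈ rot p)
    {i : Fin p} (e : g i = h i) : g = h := by
  obtain ⟨a, rfl⟩ := hg
  obtain ⟨b, rfl⟩ := hh
  ext1 j
  obtain ⟨c, rfl⟩ := exists_finRotate_pow hp i j
  have hc (d : ℤ) : (finRotate p ^ d) ((finRotate p ^ c) i) =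
      (finRotate p ^ c) ((finRotate p ^ d) i) := by
    rw [← Equiv.Perm.mul_apply, ← Equiv.Perm.mul_apply]
    congr 1
    exact ((Commute.refl (finRotate p)).zpow_left d).pow_right c
  dsimp only at e ⊢
  rw [hc, hc, e]

theorem P_eq_zpowers (h : p ≤ p + m) :
    P h = Subgroup.zpowers (permFirst h (finRotate p)) := by
  rw [P, rot, MonoidHom.map_zpowers]

theorem toWord_permFirst (h : p ≤ p + m) (τ : Equiv.Perm (Fin p)) (z : F (p + m)) :
    (permFirst h τ z).toWord = z.toWord.map fun x =>
      (Equiv.Perm.viaEmbeddingHom (Fin.castLEEmb h) τ x.1, x.2) :=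
  toWord_freeGroupCongr _ z

theorem permFirst_castAdd (h : p ≤ p + m) (τ : Equiv.Perm (Fin p)) (i : Fin p) :
    permFirst h τ (of (Fin.castAdd m i)) = of (Fin.castAdd m (τ i)) := by
  simp [permFirst_eq]

@[simp]
theorem permFirst_inr (h : p ≤ p + m) (τ : Equiv.Perm (Fin p)) (v : F m) :
    permFirst h τ (inr p m v) = inr p m v := by
  simp [permFirst_eq]

/-- The fixed subgroup of the rotation is generated by the last `m` generators. -/
theorem mem_range_inr_of_fixed (hp : 2 ≤ p) (h : p ≤ p + m) {z : F (p + m)}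
    (hz : permFirst h (finRotate p) z = z) : ∃ v, inr p m v = z := by
  rw [← mk_toWord (x := z)]
  apply mem_range_inr
  rintro ⟨y, b⟩ hy
  have h1 := toWord_permFirst h (finRotate p) z
  rw [hz] at h1
  have h2 := List.map_inj_left.1 (h1.symm.trans (List.map_id _).symm) _ hy
  have h3 := congrArg Prod.fst h2
  dsimp only [id] at h3
  induction y using Fin.addCases with
  | left i =>
    rw [viaEmbeddingHom_castAdd] at h3
    exact absurd (Fin.castAdd_injective p m h3) (finRotate_apply_ne hp i)
  | right j => exact ⟨j, rfl⟩

/-! ### Elements of the normalizer -/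

theorem permFirst_commute_sigma (h : p ≤ p + m) (τ : Equiv.Perm (Fin p)) :
    Commute (permFirst h τ) (sigma (p + m)) := by
  rw [permFirst_eq, sigma_add]
  exact (Commute.prod (sigma_commute_permAut τ).symm (Commute.one_left _)).map (prodAut p m)

/-- `P` and `⟨σ⟩` commute, so every element of their join is a product. -/
theorem exists_of_mem_sup (h : p ≤ p + m) {x : MulAut (F (p + m))}
    (hx : x ∈ P h ⊔ Subgroup.zpowers (sigma (p + m))) :
    ∃ (k : ℤ) (y : Subgroup.zpowers (sigma (p + m))),
      x = permFirst h (finRotate p) ^ k * y := by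
  have hc : ∀ a b, Commute ((P h).subtype a) ((Subgroup.zpowers (sigma (p + m))).subtype b) := by
    rintro ⟨_, τ, -, rfl⟩ ⟨_, l, rfl⟩
    exact (permFirst_commute_sigma h τ).zpow_right l
  have hr := MonoidHom.noncommCoprod_range _ _ hc
  rw [Subgroup.range_subtype, Subgroup.range_subtype] at hr
  rw [← hr] at hx
  obtain ⟨⟨⟨a, ha⟩, b⟩, rfl⟩ := hx
  rw [P_eq_zpowers] at ha
  obtain ⟨k, rfl⟩ := ha
  exact ⟨k, b, rfl⟩

theorem pow_eq_self_of_odd {G : Type*} [Group G] {x : G} (hx : x * x = 1) {k : ℕ} (hk : Odd k) :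
    x ^ k = x := by
  obtain ⟨r, rfl⟩ := hk
  rw [pow_succ, pow_mul, pow_two, hx, one_pow, one_mul]

/-- The involution `σ` is the only one in `P × ⟨σ⟩`, because `P` has odd order; so it is fixed by
conjugation. -/
theorem commute_sigma_of_mem_normalizer (hp : 2 ≤ p) (hodd : Odd p) (h : p ≤ p + m)
    {α : MulAut (F (p + m))}
    (hα : α ∈ Subgroup.normalizer
      ((P h ⊔ Subgroup.zpowers (sigma (p + m)) : Subgroup (MulAut (F (p + m)))) :
        Set (MulAut (F (p + m))))) :
    Commute (sigma (p + m)) α := by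
  have hmem := (Subgroup.mem_normalizer_iff.1 hα (sigma (p + m))).1
    (Subgroup.mem_sup_right (Subgroup.mem_zpowers _))
  obtain ⟨k, y, hy⟩ := exists_of_mem_sup h hmem
  set t := permFirst h (finRotate p) with ht
  have htp : t ^ p = 1 := by rw [ht, ← map_pow, finRotate_pow_self hp, map_one]
  have hyy : (y : MulAut (F (p + m))) * y = 1 := by
    rcases mem_zpowers_sigma y with e | e <;> simp [e, sigma_mul_self]
  have hcy : Commute t (y : MulAut (F (p + m))) := by
    rcases mem_zpowers_sigma y with e | e
    · simp [e]
    · rw [e]; exact permFirst_commute_sigma h _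
  have h1 : (t ^ k) * (t ^ k) = 1 := by
    have e1 : (α * sigma (p + m) * α⁻¹) * (α * sigma (p + m) * α⁻¹) = 1 := by
      rw [_root_.conj_mul, sigma_mul_self, mul_one, mul_inv_cancel]
    rw [hy, mul_assoc, ← mul_assoc _ (t ^ k), ← (hcy.zpow_left k).eq, mul_assoc, hyy, mul_one]
      at e1
    exact e1
  -- `t` has odd order, so `t ^ (2 * k) = 1` forces `t ^ k = 1`.
  have h2 : t ^ k = 1 := by
    have e2 : (t ^ k) ^ p = 1 := by
      rw [← zpow_natCast, ← zpow_mul, mul_comm, zpow_mul, zpow_natCast, htp, one_zpow]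
    rwa [pow_eq_self_of_odd h1 hodd] at e2
  rw [h2, one_mul] at hy
  rcases mem_zpowers_sigma y with e | e
  · rw [e, conj_eq_one_iff] at hy
    exact absurd hy (sigma_ne_one (by omega))
  · rw [e, mul_inv_eq_iff_eq_mul] at hy
    exact hy.symm

/-- The elements of odd order of `P × ⟨σ⟩` are those of `P`, so conjugation sends the rotation to one
of its powers. -/
theorem semiconj_of_mem_normalizer (hp : 2 ≤ p) (hodd : Odd p) (h : p ≤ p + m)
    {α : MulAut (F (p + m))}
    (hα : α ∈ Subgroup.normalizer
      ((P h ⊔ Subgroup.zpowers (sigma (p + m)) : Subgroup (MulAut (F (p + m)))) :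
        Set (MulAut (F (p + m))))) :
    ∃ k : ℤ, SemiconjBy α (permFirst h (finRotate p)) (permFirst h (finRotate p) ^ k) := by
  have hmem := (Subgroup.mem_normalizer_iff.1 hα (permFirst h (finRotate p))).1
    (Subgroup.mem_sup_left (by rw [P_eq_zpowers]; exact Subgroup.mem_zpowers _))
  obtain ⟨k, y, hy⟩ := exists_of_mem_sup h hmem
  set t := permFirst h (finRotate p) with ht
  have htp : t ^ p = 1 := by rw [ht, ← map_pow, finRotate_pow_self hp, map_one]
  refine ⟨k, ?_⟩
  rcases mem_zpowers_sigma y with e | e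
  · rw [e, mul_one, mul_inv_eq_iff_eq_mul] at hy
    exact hy
  · exfalso
    have e1 : (α * t * α⁻¹) ^ p = 1 := by rw [conj_pow, htp, mul_one, mul_inv_cancel]
    have e2 : (t ^ k) ^ p = 1 := by
      rw [← zpow_natCast, ← zpow_mul, mul_comm, zpow_mul, zpow_natCast, htp, one_zpow]
    have hc : Commute (t ^ k) (sigma (p + m)) := (permFirst_commute_sigma h _).zpow_left k
    rw [hy, e, hc.mul_pow, e2, one_mul] at e1
    rw [pow_eq_self_of_odd (sigma_mul_self _) hodd] at e1
    exact sigma_ne_one (by omega) e1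

/-- An automorphism normalizing the rotations preserves their fixed subgroup, the second free factor.
The hypothesis on `α⁻¹` makes the restriction bijective there. -/
theorem exists_restrict (hp : 2 ≤ p) (h : p ≤ p + m) {α : MulAut (F (p + m))} {k k' : ℤ}
    (hσ : Commute (sigma (p + m)) α)
    (hk : SemiconjBy α (permFirst h (finRotate p)) (permFirst h (finRotate p) ^ k))
    (hk' : SemiconjBy α⁻¹ (permFirst h (finRotate p)) (permFirst h (finRotate p) ^ k')) :
    ∃ β ∈ PiA m, ∀ v, α (inr p m v) = inr p m (β v) := by
  have key : ∀ {γ : MulAut (F (p + m))} {l : ℤ},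
      SemiconjBy γ⁻¹ (permFirst h (finRotate p)) (permFirst h (finRotate p) ^ l) →
      ∃ f : F m →* F m, ∀ v, inr p m (f v) = γ (inr p m v) := by
    intro γ l hl
    have h1 : ∀ v, ∃ u, inr p m u = γ (inr p m v) := by
      intro v
      apply mem_range_inr_of_fixed hp h
      have e : permFirst h (finRotate p) * γ = γ * permFirst h (finRotate p) ^ l := by
        have := hl.eq
        rw [inv_mul_eq_iff_eq_mul, ← mul_assoc, eq_mul_inv_iff_mul_eq] at this
        exact this
      have := DFunLike.congr_fun e (inr p m v)
      rwa [← map_zpow, MulAut.mul_apply, MulAut.mul_apply, permFirst_inr] at this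
    choose u hu using h1
    refine ⟨FreeGroup.lift fun j => u (of j), fun v => ?_⟩
    have : (inr p m).comp (FreeGroup.lift fun j => u (of j)) = γ.toMonoidHom.comp (inr p m) := by
      ext j
      simp [hu]
    exact DFunLike.congr_fun this v
  obtain ⟨f, hf⟩ := key hk'
  obtain ⟨g, hg⟩ := key (γ := α⁻¹) (by rwa [inv_inv])
  let β : MulAut (F m) := MonoidHom.toMulEquiv f g
    (by ext1 j; apply inr_injective (p := p); simp [hf, hg])
    (by ext1 j; apply inr_injective (p := p); simp [hf, hg])
  have hβ : ∀ v, inr p m (β v) = α (inr p m v) := hf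
  refine ⟨β, (palindromic_iff_commute β).2 ?_, fun v => (hβ v).symm⟩
  ext v
  apply inr_injective (p := p)
  have := DFunLike.congr_fun hσ.eq (inr p m v)
  simp only [MulAut.mul_apply, sigma_inr] at this
  rw [MulAut.mul_apply, MulAut.mul_apply, ← sigma_inr, hβ, hβ, this]

/-! ### Membership in the image -/

theorem twist_mem_range (hp : 0 < p) (w : F m) : twist p m w ∈ (fullHom m hp).range :=
  ⟨(1, SemidirectProduct.inl w), by
    have h1 : prodAut p m (1, 1) = 1 := map_one _
    simp [fullHom_apply, h1]⟩

theorem prodAut_snd_mem_range (hp : 0 < p) {β : MulAut (F m)} (hβ : β ∈ PiA m) :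
    prodAut p m (1, β) ∈ (fullHom m hp).range :=
  ⟨(1, SemidirectProduct.inr (1, ⟨β, hβ⟩)), by
    have h1 : prodAut p m (1, 1) = 1 := map_one _
    simp [fullHom_apply, h1]⟩

theorem prodAut_sigma_mem_range (hp : 0 < p) :
    prodAut p m (sigma p, 1) ∈ (fullHom m hp).range :=
  ⟨(1, SemidirectProduct.inr (⟨sigma p, Subgroup.mem_zpowers _⟩, 1)), by
    have h1 : prodAut p m (1, 1) = 1 := map_one _
    simp [fullHom_apply, h1]⟩

theorem prodAut_perm_mem_range (hp : 0 < p) {τ : Equiv.Perm (Fin p)}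
    (hτ : τ ∈ Subgroup.normalizer (rot p : Set (Equiv.Perm (Fin p)))) :
    prodAut p m (permAut p τ, 1) ∈ (fullHom m hp).range :=
  ⟨(⟨τ, hτ⟩, 1), by
    have h1 : prodAut p m (1, 1) = 1 := map_one _
    simp [fullHom_apply, h1]⟩

theorem mem_normalizer_sup {G : Type*} [Group G] {A B : Subgroup G} {g : G}
    (hA : g ∈ Subgroup.normalizer (A : Set G)) (hB : g ∈ Subgroup.normalizer (B : Set G)) :
    g ∈ Subgroup.normalizer ((A ⊔ B : Subgroup G) : Set G) := by
  rw [Subgroup.mem_normalizer_iff_map_conj_eq] at *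
  rw [Subgroup.map_sup, hA, hB]

theorem mem_normalizer_zpowers {G : Type*} [Group G] {g x : G} (h : Commute x g) :
    g ∈ Subgroup.normalizer (Subgroup.zpowers x : Set G) := by
  apply Subgroup.centralizer_le_normalizer
  rw [Subgroup.mem_centralizer_iff]
  rintro _ ⟨k, rfl⟩
  exact h.zpow_left k

theorem range_le_normalizer (hp : 0 < p) (h : p ≤ p + m) :
    (fullHom m hp).range ≤ Subgroup.normalizer
      ((P h ⊔ Subgroup.zpowers (sigma (p + m)) : Subgroup (MulAut (F (p + m)))) :
        Set (MulAut (F (p + m)))) := by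
  rintro _ ⟨⟨τ, x⟩, rfl⟩
  change prodAut p m (permAut p τ, 1) * semidirectHom hp x ∈ _
  apply mul_mem
  · rw [← permFirst_eq h]
    exact mem_normalizer_sup (Subgroup.le_normalizer_map _ (Subgroup.mem_map_of_mem _ τ.2))
      (mem_normalizer_zpowers (permFirst_commute_sigma h _).symm)
  · apply mem_normalizer_sup
    · rw [P_eq_zpowers, permFirst_eq]
      exact mem_normalizer_zpowers (permAut_commute_semidirectHom hp _ x)
    · apply mem_normalizer_zpowers
      rw [semidirectHom_apply]
      refine (twist_commute_sigma _).mul_right ?_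
      rw [sigma_add]
      refine (Commute.prod ?_ ((palindromic_iff_commute _).1 x.right.2.2)).map (prodAut p m)
      rcases mem_zpowers_sigma x.right.1 with e | e <;> simp [e]

/-! ### Absence of cancellation -/

/-- An automorphism normalizing the rotations sends the first `p` generators to rotations of the
image of any one of them. -/
theorem exists_rot_apply (hp : 2 ≤ p) (h : p ≤ p + m) {α : MulAut (F (p + m))} {k : ℤ}
    (hk : SemiconjBy α (permFirst h (finRotate p)) (permFirst h (finRotate p) ^ k))
    (i₀ i : Fin p) :
    ∃ g ∈ rot p, α (of (Fin.castAdd m i)) = permFirst h g (α (of (Fin.castAdd m i₀))) := by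
  obtain ⟨c, rfl⟩ := exists_finRotate_pow hp i₀ i
  refine ⟨(finRotate p ^ k) ^ c, pow_mem (Subgroup.zpow_mem _ (Subgroup.mem_zpowers _) k) c, ?_⟩
  have := DFunLike.congr_fun (hk.pow_right c).eq (of (Fin.castAdd m i₀))
  rwa [← map_pow, MulAut.mul_apply, MulAut.mul_apply, permFirst_castAdd, ← map_zpow, ← map_pow]
    at this

theorem mk_singleton_false {α : Type*} (x : α) : (mk [(x, false)] : FreeGroup α) = (of x)⁻¹ := by
  simp [of, invRev]

/-- If the image of each of the first `p` generators begins and ends with the same letter, these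
letters being distinct up to sign, and the other generators are fixed, then no cancellation occurs
between images of letters; surjectivity then makes some of these images a single letter. -/
theorem exists_length_eq_one (hp : 0 < p) {α : MulAut (F (p + m))}
    (hb : ∀ j, α (of (Fin.natAdd p j)) = of (Fin.natAdd p j))
    {τ : Fin p → Fin p} (hτ : Function.Injective τ) {e : Bool}
    (hhead : ∀ i, (α (of (Fin.castAdd m i))).toWord.head? = some (Fin.castAdd m (τ i), e))
    (hlast : ∀ i, (α (of (Fin.castAdd m i))).toWord.getLast? = some (Fin.castAdd m (τ i), e)) :
    ∃ i, (α (of (Fin.castAdd m i))).toWord.length = 1 := by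
  have hL : ∀ i s, (α (mk [(Fin.castAdd m i, s)])).toWord.head? =
        some (Fin.castAdd m (τ i), s == e) ∧
      (α (mk [(Fin.castAdd m i, s)])).toWord.getLast? = some (Fin.castAdd m (τ i), s == e) := by
    intro i s
    cases s
    · rw [mk_singleton_false, map_inv, toWord_inv, invRev, List.head?_reverse,
        List.getLast?_reverse, List.getLast?_map, List.head?_map, hhead, hlast]
      simp
    · change (α (of _)).toWord.head? = _ ∧ (α (of _)).toWord.getLast? = _
      rw [hhead, hlast]
      simp
  have hR : ∀ j s, (α (mk [(Fin.natAdd p j, s)])).toWord = [(Fin.natAdd p j, s)] := by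
    intro j s
    cases s
    · rw [mk_singleton_false, map_inv, hb, ← mk_singleton_false, toWord_mk,
        FreeGroup.reduce_singleton]
    · change (α (of _)).toWord = _
      rw [hb, FreeGroup.toWord_of]
  have hcross (i : Fin p) (j : Fin m) : Fin.castAdd m i ≠ Fin.natAdd p j := by
    intro h
    have := congrArg Fin.val h
    simp at this
    omega
  have hflat := toWord_hom_eq_flatMap α.toMonoidHom (fun x => by simp) (by
    rintro ⟨x, s⟩ ⟨y, s'⟩ hxy a ha b hb
    simp only [MulEquiv.coe_toMonoidHom] at ha hb
    dsimp only at hxy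
    induction x using Fin.addCases with
    | left i =>
      rw [(hL i s).2] at ha
      obtain rfl := Option.some.inj ha
      induction y using Fin.addCases with
      | left j =>
        rw [(hL j s').1] at hb
        obtain rfl := Option.some.inj hb
        intro h
        rw [hxy (congrArg _ (hτ (Fin.castAdd_injective p m h)))]
      | right j =>
        rw [hR] at hb
        obtain rfl := Option.some.inj hb
        intro h
        exact absurd h (hcross _ _)
    | right i =>
      rw [hR] at ha
      obtain rfl := Option.some.inj ha
      induction y using Fin.addCases with
      | left j =>
        rw [(hL j s').1] at hb
        obtain rfl := Option.some.inj hb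
        intro h
        exact absurd h.symm (hcross _ _)
      | right j =>
        rw [hR] at hb
        obtain rfl := Option.some.inj hb
        exact hxy) (α⁻¹ (of (Fin.castAdd m ⟨0, hp⟩)))
  simp only [MulEquiv.coe_toMonoidHom, MulAut.apply_inv_self, FreeGroup.toWord_of] at hflat
  -- The one-letter word on the left is a concatenation of nonempty words.
  cases hz : (α⁻¹ (of (Fin.castAdd m ⟨0, hp⟩))).toWord with
  | nil =>
    rw [hz] at hflat
    exact absurd hflat (by simp)
  | cons y L =>
    obtain ⟨y, s⟩ := y
    rw [hz, List.flatMap_cons] at hflat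
    induction y using Fin.addCases with
    | left i =>
      refine ⟨i, ?_⟩
      have h1 : (α (mk [(Fin.castAdd m i, s)])).toWord.length =
          (α (of (Fin.castAdd m i))).toWord.length := by
        cases s
        · rw [mk_singleton_false, map_inv]
          exact FreeGroup.norm_inv_eq
        · rfl
      have h2 : (α (of (Fin.castAdd m i))).toWord ≠ [] := by
        intro h0
        have := hhead i
        simp [h0] at this
      have h3 := congrArg List.length hflat
      have h4 := List.length_pos_iff.2 h2
      simp only [List.length_append, List.length_cons, List.length_nil] at h3
      omega
    | right j =>
      rw [hR] at hflat
      simp only [List.cons_append, List.cons.injEq, Prod.mk.injEq] at hflat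
      exact absurd hflat.1.1 (hcross _ _)

/-- An automorphism permuting the first `p` generators up to a common sign, fixing the others
and normalizing the rotations, lies in the image. -/
theorem signed_perm_mem_range (hp : 0 < p) (h : p ≤ p + m) {α : MulAut (F (p + m))} {k : ℤ}
    (hk : SemiconjBy α (permFirst h (finRotate p)) (permFirst h (finRotate p) ^ k))
    (hb : ∀ j, α (of (Fin.natAdd p j)) = of (Fin.natAdd p j))
    {τ : Fin p → Fin p} (hτ : Function.Injective τ) {e : Bool}
    (hα : ∀ i, α (of (Fin.castAdd m i)) = mk [(Fin.castAdd m (τ i), e)]) :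
    α ∈ (fullHom m hp).range := by
  let τ' : Equiv.Perm (Fin p) := Equiv.ofBijective τ (Finite.injective_iff_bijective.1 hτ)
  have hτ' : ∀ i, τ' i = τ i := fun _ => rfl
  -- Comparing the images of the first `p` generators shows that `τ'` conjugates the rotation to
  -- its `k`-th power.
  have hconj : SemiconjBy τ' (finRotate p) (finRotate p ^ k) := by
    ext1 i
    have h1 := congrArg toWord (DFunLike.congr_fun hk.eq (of (Fin.castAdd m i)))
    rw [← map_zpow, MulAut.mul_apply, MulAut.mul_apply, permFirst_castAdd, hα, hα,
      toWord_permFirst, toWord_mk, toWord_mk, FreeGroup.reduce_singleton,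
      FreeGroup.reduce_singleton, List.map_singleton, viaEmbeddingHom_castAdd] at h1
    simp only [List.cons.injEq, Prod.mk.injEq, and_true] at h1
    exact Fin.castAdd_injective p m h1
  have hnorm : τ' ∈ Subgroup.normalizer (rot p : Set (Equiv.Perm (Fin p))) := by
    apply Subgroup.mem_normalizer_fintype
    rintro _ ⟨c, rfl⟩
    have := hconj.zpow_right c
    dsimp only
    rw [this.eq, mul_inv_cancel_right]
    exact Subgroup.zpow_mem _ (Subgroup.zpow_mem _ (Subgroup.mem_zpowers _) k) c
  cases e
  · have : α = prodAut p m (permAut p τ', 1) * prodAut p m (sigma p, 1) := by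
      apply aut_ext <;> intro i
      · rw [hα, mk_singleton_false]
        simp [hτ']
      · rw [hb]
        simp
    rw [this]
    exact mul_mem (prodAut_perm_mem_range hp hnorm) (prodAut_sigma_mem_range hp)
  · have : α = prodAut p m (permAut p τ', 1) := by
      apply aut_ext <;> intro i
      · rw [hα, prodAut_castAdd, permAut_of, inl_of]
        rfl
      · rw [hb]
        simp
    rw [this]
    exact prodAut_perm_mem_range hp hnorm

/-- The case in which the image of a generator begins and ends with the same letter among the
first `p`. -/
theorem mem_range_of_head_of_last (hp : 2 ≤ p) (h : p ≤ p + m) {α : MulAut (F (p + m))} {k : ℤ}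
    (hk : SemiconjBy α (permFirst h (finRotate p)) (permFirst h (finRotate p) ^ k))
    (hb : ∀ j, α (of (Fin.natAdd p j)) = of (Fin.natAdd p j)) {i₀ l : Fin p} {e : Bool}
    (hhead : (α (of (Fin.castAdd m i₀))).toWord.head? = some (Fin.castAdd m l, e))
    (hlast : (α (of (Fin.castAdd m i₀))).toWord.getLast? = some (Fin.castAdd m l, e)) :
    α ∈ (fullHom m (by omega : 0 < p)).range := by
  choose g hg hα using exists_rot_apply hp h hk i₀
  have hinj : Function.Injective fun i => g i l := by
    intro i j hij
    have := eq_of_mem_rot hp (hg i) (hg j) hij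
    apply Fin.castAdd_injective p m
    apply FreeGroup.of_injective
    apply α.injective
    rw [hα i, hα j, this]
  obtain ⟨i₁, hi₁⟩ := exists_length_eq_one (by omega) hb hinj (e := e)
    (fun i => by rw [hα, toWord_permFirst, List.head?_map, hhead]; simp [viaEmbeddingHom_castAdd])
    (fun i => by
      rw [hα, toWord_permFirst, List.getLast?_map, hlast]; simp [viaEmbeddingHom_castAdd])
  rw [hα, toWord_permFirst, List.length_map, List.length_eq_one_iff] at hi₁
  obtain ⟨x, hx⟩ := hi₁
  rw [hx] at hhead
  obtain rfl := Option.some.inj hhead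
  refine signed_perm_mem_range (by omega) h hk hb hinj (e := e) fun i => ?_
  rw [← mk_toWord (x := α _), hα i, toWord_permFirst, hx]
  simp [viaEmbeddingHom_castAdd]

/-- A palindromic automorphism fixing the last `m` generators and normalizing the rotations is a
signed permutation up to a twist, the twist stripping the image of a generator of its outer
letters. -/
theorem mem_range_of_fix (hp : 2 ≤ p) (h : p ≤ p + m) {α : MulAut (F (p + m))} {k : ℤ}
    (hσ : Commute (sigma (p + m)) α)
    (hk : SemiconjBy α (permFirst h (finRotate p)) (permFirst h (finRotate p) ^ k))
    (hb : ∀ v, α (inr p m v) = inr p m v) :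
    α ∈ (fullHom m (by omega : 0 < p)).range := by
  let i₀ : Fin p := ⟨0, by omega⟩
  let B : Fin (p + m) × Bool → Prop := fun y =>
    y.1 ∈ Set.range (Fin.natAdd p : Fin m → Fin (p + m))
  have hpal : (α (of (Fin.castAdd m i₀))).toWord.Palindrome :=
    List.Palindrome.of_reverse_eq ((palindromic_iff_commute α).2 hσ _)
  have hB : ∃ y ∈ (α (of (Fin.castAdd m i₀))).toWord, ¬ B y := by
    by_contra! hall
    obtain ⟨v, hv⟩ := mem_range_inr hall
    rw [mk_toWord, ← hb, α.injective.eq_iff] at hv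
    have h1 := permFirst_inr h (finRotate p) v
    rw [hv, permFirst_castAdd] at h1
    exact finRotate_apply_ne hp i₀ (Fin.castAdd_injective p m (FreeGroup.of_injective h1))
  obtain ⟨u, M, ⟨x, e⟩, hw, hu, hx, hhead, hlast⟩ := exists_palindrome_core B hpal hB
  obtain ⟨v, hv⟩ := mem_range_inr hu
  have hrev : mk u.reverse = (inr p m (sigma m v))⁻¹ := by
    rw [← sigma_inr, hv, sigma_mk, inv_inv]
  have hM : (α * twist p m v) (of (Fin.castAdd m i₀)) = mk M := by
    rw [MulAut.mul_apply, twist_castAdd, map_mul, map_mul, map_inv, hb, hb,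
      ← mk_toWord (x := α (of _)), hw, ← mul_mk, ← mul_mk, hrev, ← hv]
    group
  have hMred : (mk M).toWord = M := by
    rw [toWord_mk]
    refine (FreeGroup.IsReduced.infix
      (isReduced_toWord (x := α (of (Fin.castAdd m i₀)))) ?_).reduce_eq
    rw [hw]
    exact ⟨u, u.reverse, rfl⟩
  have hk' : SemiconjBy (α * twist p m v) (permFirst h (finRotate p))
      (permFirst h (finRotate p) ^ k) := by
    refine hk.mul_left ?_
    rw [permFirst_eq]
    exact (twist_commute_permAut v _).symm
  induction x using Fin.addCases with
  | right j => exact absurd ⟨j, rfl⟩ hx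
  | left l =>
    have h1 := mem_range_of_head_of_last hp h hk' (fun j => by simp [← inr_of, hb])
      (i₀ := i₀) (l := l) (e := e) (by rw [hM, hMred, hhead]) (by rw [hM, hMred, hlast])
    rwa [Subgroup.mul_mem_cancel_right _ (twist_mem_range _ v)] at h1

theorem normalizer_le_range (hp : 2 ≤ p) (hodd : Odd p) (h : p ≤ p + m) :
    Subgroup.normalizer
      ((P h ⊔ Subgroup.zpowers (sigma (p + m)) : Subgroup (MulAut (F (p + m)))) :
        Set (MulAut (F (p + m)))) ≤ (fullHom m (by omega : 0 < p)).range := by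
  intro α hα
  have hσ := commute_sigma_of_mem_normalizer hp hodd h hα
  obtain ⟨k, hk⟩ := semiconj_of_mem_normalizer hp hodd h hα
  obtain ⟨k', hk'⟩ := semiconj_of_mem_normalizer hp hodd h (inv_mem hα)
  obtain ⟨β, hβ, hαβ⟩ := exists_restrict hp h hσ hk hk'
  have hβσ : Commute (sigma m) β := (palindromic_iff_commute β).1 hβ
  have hβ' := inv_mem (prodAut_snd_mem_range (p := p) (by omega) hβ)
  rw [← map_inv] at hβ'
  rw [← Subgroup.mul_mem_cancel_right _ hβ']
  apply mem_range_of_fix hp h (k := k)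
  · refine hσ.mul_right ?_
    rw [sigma_add]
    exact (Commute.prod (Commute.one_right _).inv_right hβσ.inv_right).map (prodAut p m)
  · refine hk.mul_left ?_
    rw [permFirst_eq]
    exact (Commute.prod (Commute.one_left _).inv_left (Commute.one_right _)).map (prodAut p m)
  · intro v
    simp [hαβ]

end PalAut

theorem propositionc20 (p n m : ℕ) (hp : p.Prime) (hodd : Odd p) (hpn : p ≤ n)
    (hm : m = n - p) :
    Nonempty
      (Subgroup.normalizer
          ((PalAut.P hpn ⊔ Subgroup.zpowers (PalAut.sigma n) :
            Subgroup (MulAut (PalAut.F n))) : Set (MulAut (PalAut.F n))) ≃*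
        Subgroup.normalizer (PalAut.rot p : Set (Equiv.Perm (Fin p))) ×
          (PalAut.F m ⋊[PalAut.act p m]
            (Subgroup.zpowers (PalAut.sigma p) × PalAut.PiA m))) := by
  obtain rfl : n = p + m := by omega
  have hrange := le_antisymm (PalAut.range_le_normalizer hp.pos hpn)
    (PalAut.normalizer_le_range hp.two_le hodd hpn)
  exact ⟨((MonoidHom.ofInjective (PalAut.fullHom_injective hp.pos)).trans
    (MulEquiv.subgroupCongr hrange)).symm⟩
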